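/- All structures are multisorted relational structures: a signature consists of a set of types and a set of relational symbols, the arity $\mathrm{ar}_R$ of a symbol $R$ being a finite tuple of types; a structure $\mathbf A$ has a set $A_t$ for each type $t$ and a relation $R^{\mathbf A}\subseteq\prod_i A_{\mathrm{ar}_R(i)}$ for each symbol $R$; elements of different types are considered different. Homomorphisms preserve types and relations, and $\mathbf X\to\mathbf A$ means that a homomorphism exists. Fix a finite signature $\Pi$ and an integer $k\ge 1$, and let $\mathbf A,\mathbf A'$ be $\Pi$-structures with $\mathbf A$ finite and $\mathbf A\to\mathbf A'$. An instance $\mathbf X$ of $\mathrm{PCSP}(\mathbf A,\mathbf A')$ is a finite $\Pi$-structure; it is positive if $\mathbf X\to\mathbf A$ and negative if $\mathbf X\not\to\mathbf A'$. *$k$-consistency.* For each set $K$ of at most $k$ elements of $\mathbf X$, let $\mathcal F_K$ initially be the set of all partial homomorphisms from $K$ to $\mathbf A$ (type-preserving maps $f\colon K\to A$ that preserve every relation on the tuples with all entries in $K$). As long as anything changes, for all $L\subseteq K$ with $|K|\le k$, remove from $\mathcal F_L$ all maps that do not extend to a member of $\mathcal F_K$, and remove from $\mathcal F_K$ all maps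 whose restriction to $L$ is not in $\mathcal F_L$. The *$k$-consistency test* accepts $\mathbf X$ if all the resulting sets $\mathcal F_K$ are non-empty, and rejects it otherwise. $\mathrm{PCSP}(\mathbf A,\mathbf A')$ *has width (at most) $k$* if the test accepts all positive instances and rejects all negative instances. *$k$-consistency reduction.* For a structure $\mathbf B$ (possibly of another signature), the $k$-consistency reduction maps $\mathbf X$ to the structure $\kappa_k^{\mathbf A,\mathbf B}(\mathbf X)$ obtained from the disjoint union, over all sets $K$ of at most $k$ elements of $\mathbf X$, of copies of the powers $\mathbf B^{\mathcal F_K}$ (with elements $(K;b)$, where $b\colon\mathcal F_K\to B_t$ and $\mathcal F_K$ are the resulting sets above) by identifying $(K;b\circ\rho)$ with $(L;b)$ for all $L\subseteq K$ and $b\colon\mathcal F_L\to B_t$, where $\rho\colon\mathcal F_K\to\mathcal F_L$ is the restriction. $\mathrm{PCSP}(\mathbf A,\mathbf A')$ reduces to $\mathrm{CSP}(\mathbf B)$ by the $k$-consistency reduction if, for every instance $\mathbf X$, $\mathbf X\to\mathbf A$ implies $\kappa_k^{\mathbf A,\mathbf B}(\mathbf X)\to\mathbf B$, and $\mathbf X\not\to\mathbf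 A'$ implies $\kappa_k^{\mathbf A,\mathbf B}(\mathbf X)\not\to\mathbf B$. *Trivial CSP.* Let $\bot$ be the structure with empty relation over the signature that has no types and a single nullary symbol. The trivial CSP is $\mathrm{CSP}(\bot)$. *Datalog.* A Datalog program consists of finitely many additional relational symbols, finitely many rules $t_0\leftarrow t_1,\dots,t_r$ with $t_i$ atomic formulae in typed variables over the extended signature (equalities are allowed in the body only, and the symbol in the head $t_0$ is one of the additional symbols), and an output symbol; it is evaluated on a structure by the usual least fixed point semantics. Its width is at most $k$ if every rule contains at most $k$ variables. It is a Datalog sentence if the output symbol is nullary. **Theorem.** The following are equivalent: 1. $\mathrm{PCSP}(\mathbf A,\mathbf A')$ has width $k$, i.e. it is solved by the $k$-consistency test; 2. there is a Datalog sentence of width at most $k$ that is true in all negative instances and false in all positive instances of $\mathrm{PCSP}(\mathbf A,\mathbf A')$; 3. $\mathrm{PCSP}(\mathbf A,\mathbf A')$ reduces to $\mathrm{CSP}(\bot)$ by the $k$-consistency reduction. -/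

import Mathlib

namespace PCSP

universe u v w w'

/-- A multisorted relational signature: types, relational symbols, and for each symbol its arity,
which is a tuple (list) of types. -/
structure Signature where
  Ty : Type u
  Sym : Type v
  ar : Sym → List Ty

/-- A relational structure: a set for each type, a relation of the right arity for each symbol. -/
structure Str (S : Signature.{u, v}) where
  dom : S.Ty → Type w
  rel : (R : S.Sym) → Set ((i : Fin (S.ar R).length) → dom ((S.ar R).get i))

/-- A signature is finite if it has finitely many types and finitely many symbols. -/
def Signature.IsFinite (S : Signature.{u, v}) : Prop :=
  Finite S.Ty ∧ Finite S.Sym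

/-- A structure is finite if all its domains are. -/
def Str.IsFinite {S : Signature.{u, v}} (A : Str.{u, v, w} S) : Prop :=
  ∀ t, Finite (A.dom t)

/-- `A.MapsTo B` says that there is a homomorphism from `A` to `B`. -/
def Str.MapsTo {S : Signature.{u, v}} (A : Str.{u, v, w} S) (B : Str.{u, v, w'} S) : Prop :=
  ∃ f : (t : S.Ty) → A.dom t → B.dom t,
    ∀ (R : S.Sym) (a : (i : Fin (S.ar R).length) → A.dom ((S.ar R).get i)),
      a ∈ A.rel R → (fun i => f _ (a i)) ∈ B.rel R

/-- The elements of a structure; elements of different types are different. -/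
abbrev Str.Elem {S : Signature.{u, v}} (A : Str.{u, v, w} S) : Type (max u w) :=
  Σ t : S.Ty, A.dom t

/-- The power of a structure with exponent `I`. -/
def Str.pow {S : Signature.{u, v}} (B : Str.{u, v, w} S) (I : Type w') :
    Str.{u, v, max w w'} S where
  dom t := I → B.dom t
  rel R := {b | ∀ j : I, (fun i => b i j) ∈ B.rel R}

/-- `ψ` is a reduction from the promise CSP with template `(A, A')` to the one with template
`(B, B')`. The inputs are the finite structures. -/
def IsReduction {P : Signature.{u, v}} {S : Signature} (A A' : Str.{u, v, w} P)
    (B B' : Str S) (ψ : Str.{u, v, w} P → Str S) : Prop :=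
  (∀ X : Str.{u, v, w} P, X.IsFinite → X.MapsTo A → (ψ X).MapsTo B) ∧
  (∀ X : Str.{u, v, w} P, X.IsFinite → ¬ X.MapsTo A' → ¬ (ψ X).MapsTo B')

/-- The decision procedure with the set `acc` of accepted structures solves the promise CSP with
template `(A, A')`. -/
def Solves {P : Signature.{u, v}} (acc : Str.{u, v, w} P → Prop) (A A' : Str.{u, v, w} P) :
    Prop :=
  (∀ X : Str.{u, v, w} P, X.IsFinite → X.MapsTo A → acc X) ∧
  (∀ X : Str.{u, v, w} P, X.IsFinite → ¬ X.MapsTo A' → ¬ acc X)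

/-! ### The trivial CSP -/

/-- The signature without types and with a single nullary symbol. -/
def trivialSig : Signature.{0, 0} where
  Ty := Empty
  Sym := Unit
  ar _ := []

/-- The structure over the trivial signature whose nullary relation is empty. -/
def botStr : Str.{0, 0, 0} trivialSig where
  dom t := nomatch t
  rel _ := ∅

/-! ### Enforcing consistency -/

section Consistency

variable {P : Signature.{u, v}}

/-- Type-preserving maps from a finite set `K` of elements of `X` to `A`. -/
abbrev PMap (X A : Str.{u, v, w} P) (K : Finset X.Elem) : Type (max u w) :=
  (x : {x : X.Elem // x ∈ K}) → A.dom x.1.1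

/-- Restriction of a map defined on `K` to a subset `L`. -/
def PMap.restrict {X A : Str.{u, v, w} P} {K L : Finset X.Elem} (h : L ⊆ K) (g : PMap X A K) :
    PMap X A L :=
  fun x => g ⟨x.1, h x.2⟩

/-- `f` is a partial homomorphism from `K` to `A`. -/
def PMap.IsPartialHom {X A : Str.{u, v, w} P} {K : Finset X.Elem} (f : PMap X A K) : Prop :=
  ∀ (R : P.Sym) (a : (i : Fin (P.ar R).length) → X.dom ((P.ar R).get i))
    (ha : ∀ i, (⟨(P.ar R).get i, a i⟩ : X.Elem) ∈ K),
    a ∈ X.rel R → (fun i => f ⟨⟨(P.ar R).get i, a i⟩, ha i⟩) ∈ A.rel R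

/-- The sets of maps after `n` rounds of enforcing consistency between the sets of at most `k`
elements: at first all partial homomorphisms, and then each round removes the maps that have a
restriction which is not in the respective set, or fail to extend to some set of size at most
`k`. -/
def rounds (k : ℕ) (A X : Str.{u, v, w} P) : ℕ → (K : Finset X.Elem) → Set (PMap X A K)
  | 0, _ => {f | f.IsPartialHom}
  | n + 1, K => {f | f ∈ rounds k A X n K ∧
      (∀ (L : Finset X.Elem) (h : L ⊆ K), f.restrict h ∈ rounds k A X n L) ∧
      (∀ (M : Finset X.Elem) (h : K ⊆ M), M.card ≤ k →
        ∃ g ∈ rounds k A X n M, g.restrict h = f)}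

/-- The sets output by the `k`-consistency algorithm: the maps that are never removed. (For finite
`X` and `A`, the decreasing sequence of rounds stabilises and this is its final value.) -/
def consistent (k : ℕ) (A X : Str.{u, v, w} P) (K : Finset X.Elem) : Set (PMap X A K) :=
  {f | ∀ n, f ∈ rounds k A X n K}

theorem restrict_mem_consistent {k : ℕ} {A X : Str.{u, v, w} P} {K L : Finset X.Elem}
    (h : L ⊆ K) {g : PMap X A K} (hg : g ∈ consistent k A X K) :
    g.restrict h ∈ consistent k A X L :=
  fun n => (hg (n + 1)).2.1 L h

/-- The `k`-consistency test accepts `X` if all the sets output by the `k`-consistency algorithm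
are non-empty. -/
def TestAccepts (k : ℕ) (A X : Str.{u, v, w} P) : Prop :=
  ∀ K : Finset X.Elem, K.card ≤ k → (consistent k A X K).Nonempty

/-- The promise CSP with template `(A, A')` has width (at most) `k`: it is solved by the
`k`-consistency test. -/
def HasWidth (k : ℕ) (A A' : Str.{u, v, w} P) : Prop :=
  Solves (TestAccepts k A) A A'

/-! ### The consistency reduction -/

/-- The sets of at most `k` elements of `X`. -/
abbrev SmallSet (k : ℕ) (X : Str.{u, v, w} P) : Type (max u w) :=
  {K : Finset X.Elem // K.card ≤ k}

/-- The elements `(K; b)` of type `t` of the disjoint union, over all sets `K` of at most `k`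
elements, of copies of the powers of `B` with exponent `consistent k A X K`. -/
abbrev PreElem {S : Signature} (k : ℕ) (A X : Str.{u, v, w} P) (B : Str S) (t : S.Ty) : Type _ :=
  Σ K : SmallSet k X, (B.pow (consistent k A X K.1)).dom t

/-- The pairs `(K; b ∘ ρ)`, `(L; b)` that are identified, where `L ⊆ K` and `ρ` is the
restriction from `K` to `L`. -/
inductive Glue {S : Signature} (k : ℕ) (A X : Str.{u, v, w} P) (B : Str S) (t : S.Ty) :
    PreElem k A X B t → PreElem k A X B t → Prop
  | mk (K L : SmallSet k X) (h : L.1 ⊆ K.1) (b : consistent k A X L.1 → B.dom t) :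
      Glue k A X B t
        ⟨K, fun g => b ⟨g.1.restrict h, restrict_mem_consistent h g.2⟩⟩ ⟨L, b⟩

/-- The output of the `k`-consistency reduction (with the templates `A` and `B`) on the
structure `X`. `Quot` is the quotient by the equivalence relation generated by `Glue`. -/
def kappa {S : Signature} (k : ℕ) (A : Str.{u, v, w} P) (B : Str S) (X : Str.{u, v, w} P) :
    Str S where
  dom t := Quot (Glue k A X B t)
  rel R := {y | ∃ (K : SmallSet k X), ∃ b ∈ (B.pow (consistent k A X K.1)).rel R,
    y = fun i => Quot.mk _ ⟨K, b i⟩}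

/-- The promise CSP with template `(A, A')` reduces to the one with template `(B, B')` by the
`k`-consistency reduction. -/
def ReducesByConsistency {S : Signature} (k : ℕ) (A A' : Str.{u, v, w} P) (B B' : Str S) :
    Prop :=
  IsReduction A A' B B' (kappa k A B)

end Consistency

/-! ### Datalog -/

/-- The signature with the types of `S` and with additional symbols `I` of arities `arI`. -/
def Signature.extend (S : Signature.{u, v}) (I : Type) (arI : I → List S.Ty) :
    Signature.{u, v} where
  Ty := S.Ty
  Sym := S.Sym ⊕ I
  ar := Sum.elim S.ar arI

/-- Atomic formulae of signature `S` in typed variables: `V t` is the set of variables of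
type `t`. -/
inductive Atom (S : Signature.{u, v}) (V : S.Ty → Type) : Type (max u v)
  | rel (R : S.Sym) (x : (i : Fin (S.ar R).length) → V ((S.ar R).get i)) : Atom S V
  | eq (t : S.Ty) (x y : V t) : Atom S V

/-- A variable occurs in an atomic formula. -/
def Atom.Occurs {S : Signature.{u, v}} {V : S.Ty → Type} (x : Σ t, V t) : Atom S V → Prop
  | .rel R y => ∃ i, (⟨(S.ar R).get i, y i⟩ : Σ t, V t) = x
  | .eq t y z => (⟨t, y⟩ : Σ t, V t) = x ∨ (⟨t, z⟩ : Σ t, V t) = x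

/-- An atomic formula holds in a structure after the substitution `h`. -/
def Atom.Holds {S : Signature.{u, v}} {V : S.Ty → Type} (B : Str.{u, v, w} S)
    (h : (t : S.Ty) → V t → B.dom t) : Atom S V → Prop
  | .rel R y => (fun i => h _ (y i)) ∈ B.rel R
  | .eq t y z => h t y = h t z

/-- A Datalog rule with input signature `S` and additional symbols `I`. The head is an atomic
formula with a symbol from `I`, the body is a list of atomic formulae in the extended signature.
The variables of type `t` are numbered by `Fin (nvar t)`, and they all occur in the rule. -/
structure Rule (S : Signature.{u, v}) (I : Type) (arI : I → List S.Ty) where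
  nvar : S.Ty → ℕ
  head : I
  headArgs : (i : Fin (arI head).length) → Fin (nvar ((arI head).get i))
  body : List (Atom (S.extend I arI) (fun t => Fin (nvar t)))
  occurs : ∀ x : (Σ t : S.Ty, Fin (nvar t)),
    (∃ i, (⟨(arI head).get i, headArgs i⟩ : Σ t : S.Ty, Fin (nvar t)) = x) ∨
      ∃ a ∈ body, Atom.Occurs (S := S.extend I arI) x a

/-- The number of variables of a rule. -/
noncomputable def Rule.numVars {S : Signature.{u, v}} {I : Type} {arI : I → List S.Ty}
    (r : Rule S I arI) : ℕ∞ :=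
  ENat.card (Σ t : S.Ty, Fin (r.nvar t))

/-- A Datalog program with input signature `S`: finitely many additional (intensional) symbols,
finitely many rules, and an output symbol of the extended signature. -/
structure Program (S : Signature.{u, v}) where
  I : Type
  finite_I : Finite I
  arI : I → List S.Ty
  rules : Set (Rule S I arI)
  finite_rules : rules.Finite
  output : (S.extend I arI).Sym

namespace Program

variable {S : Signature.{u, v}}

/-- All rules have at most `k` variables. -/
def WidthAtMost (φ : Program S) (k : ℕ) : Prop :=
  ∀ r ∈ φ.rules, r.numVars ≤ k

/-- The output symbol is nullary. -/
def IsSentence (φ : Program S) : Prop :=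
  (S.extend φ.I φ.arI).ar φ.output = []

/-- The structure over the extended signature given by `X` and by an interpretation of the
intensional symbols. -/
def expand (φ : Program S) (X : Str.{u, v, w} S)
    (J : (Q : φ.I) → Set ((i : Fin (φ.arI Q).length) → X.dom ((φ.arI Q).get i))) :
    Str.{u, v, w} (S.extend φ.I φ.arI) where
  dom := X.dom
  rel
    | .inl R => X.rel R
    | .inr Q => J Q

/-- The intensional relations after `n` rounds of the evaluation on `X`: start with empty
relations; in each round, include the heads of all rules under all assignments which satisfy
the body. -/
def stage (φ : Program S) (X : Str.{u, v, w} S) :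
    ℕ → (Q : φ.I) → Set ((i : Fin (φ.arI Q).length) → X.dom ((φ.arI Q).get i))
  | 0, _ => ∅
  | n + 1, Q => stage φ X n Q ∪
      {y | ∃ r ∈ φ.rules, ∃ h : (t : S.Ty) → Fin (r.nvar t) → X.dom t,
        (∀ a ∈ r.body, a.Holds (φ.expand X (stage φ X n)) h) ∧
        (⟨r.head, fun i => h _ (r.headArgs i)⟩ :
          Σ Q : φ.I, ((i : Fin (φ.arI Q).length) → X.dom ((φ.arI Q).get i))) = ⟨Q, y⟩}

/-- The fixed point of the evaluation on `X`. -/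
def eval (φ : Program S) (X : Str.{u, v, w} S) : Str.{u, v, w} (S.extend φ.I φ.arI) :=
  φ.expand X (fun Q => {y | ∃ n, y ∈ φ.stage X n Q})

/-- A Datalog sentence is true in `X` if its (nullary) output relation is non-empty. -/
def IsTrue (φ : Program S) (X : Str.{u, v, w} S) : Prop :=
  ((φ.eval X).rel φ.output).Nonempty

end Program

/-- The promise CSP with template `(A, A')` is expressible by a Datalog sentence of width at most
`k`, which is true in all negative instances and false in all positive ones. -/
def DatalogExpressible {P : Signature.{u, v}} (k : ℕ) (A A' : Str.{u, v, w} P) : Prop :=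
  ∃ φ : Program P, φ.IsSentence ∧ φ.WidthAtMost k ∧ Solves (fun X => ¬ φ.IsTrue X) A A'

end PCSP

namespace PCSP

universe u v w

/-! ### Consistency and the trivial CSP -/

section Consistency

variable {P : Signature.{u, v}} {k : ℕ} {A X : Str.{u, v, w} P}

/-! The consistent maps form the largest family of partial homomorphisms closed under restriction
and under extension to sets of at most `k` elements (`subset_consistent`,
`exists_extension_mem_consistent`). Restrictions of a homomorphism form such a family, so positive
instances are always accepted. For `botStr`, the reduction retains only whether some exponent is
empty, which is exactly what the test asks.

From Datalog to width: an instance of a rule touches at most `k` elements, so a consistent map on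
the elements of the head extends to all of them. Hence consistent maps carry derivations from `X` to
`A` (`consistent_preserves_stage`). The sentence is false in `A`, which is itself a positive
instance, so the test rejects whenever the sentence is true.

From width to Datalog: the canonical program has a symbol for every relation on `A` of arity at most
`k`, and all rules with at most `k` variables valid in `A`. If it does not derive the symbol of the
empty nullary relation, then the maps preserving all derived facts are a non-empty closed family, so
the test accepts. The extension property holds because the traces on `L` of the maps on `K` form a
relation on `A` that has a symbol. -/

theorem rounds_succ_subset (n : ℕ) (K : Finset X.Elem) :
    rounds k A X (n + 1) K ⊆ rounds k A X n K :=
  fun _ hf => hf.1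

theorem rounds_antitone (K : Finset X.Elem) : Antitone fun n => rounds k A X n K :=
  antitone_nat_of_succ_le fun n => rounds_succ_subset n K

theorem isPartialHom_of_mem_consistent {K : Finset X.Elem} {f : PMap X A K}
    (hf : f ∈ consistent k A X K) : f.IsPartialHom :=
  hf 0

/-- A family of partial homomorphisms that is closed under restrictions and has the extension
property survives the `k`-consistency algorithm. -/
theorem subset_consistent (G : (K : Finset X.Elem) → Set (PMap X A K))
    (hhom : ∀ K, ∀ f ∈ G K, f.IsPartialHom)
    (hres : ∀ (K L : Finset X.Elem) (h : L ⊆ K), ∀ f ∈ G K, f.restrict h ∈ G L)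
    (hext : ∀ (L K : Finset X.Elem) (h : L ⊆ K), K.card ≤ k →
      ∀ f ∈ G L, ∃ g ∈ G K, g.restrict h = f) (K : Finset X.Elem) :
    G K ⊆ consistent k A X K := by
  intro f hf n
  induction n generalizing K with
  | zero => exact hhom K f hf
  | succ n ih =>
    refine ⟨ih K hf, fun L h => ih L (hres K L h f hf), fun M h hM => ?_⟩
    obtain ⟨g, hg, hgf⟩ := hext K M h hM f hf
    exact ⟨g, ih M hg, hgf⟩

/-- The sets output by the `k`-consistency algorithm have the extension property. -/
theorem exists_extension_mem_consistent (hA : A.IsFinite) {L K : Finset X.Elem} (h : L ⊆ K)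
    (hK : K.card ≤ k) {f : PMap X A L} (hf : f ∈ consistent k A X L) :
    ∃ g ∈ consistent k A X K, g.restrict h = f := by
  have : ∀ t, Finite (A.dom t) := hA
  choose g hg hgf using fun n => (hf (n + 1)).2.2 K h hK
  -- Each round gives its own extension, but there are only finitely many maps from `K` to `A`. One
  -- of them recurs in infinitely many rounds and, as the rounds decrease, lies in all of them.
  obtain ⟨g₀, hg₀⟩ := Finite.exists_infinite_fiber g
  rw [Set.infinite_coe_iff] at hg₀
  refine ⟨g₀, fun n => ?_, ?_⟩
  · obtain ⟨m, hm, hnm⟩ := hg₀.exists_gt n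
    rw [← show g m = g₀ from hm]
    exact rounds_antitone K hnm.le (hg m)
  · obtain ⟨m, hm⟩ := hg₀.nonempty
    rw [← show g m = g₀ from hm]
    exact hgf m

/-- The restrictions of a homomorphism survive the `k`-consistency algorithm. -/
theorem Str.MapsTo.testAccepts (h : X.MapsTo A) : TestAccepts k A X := by
  obtain ⟨f, hf⟩ := h
  intro K _
  refine ⟨fun x => f _ x.1.2,
    subset_consistent (fun K => {g : PMap X A K | ∀ x, g x = f x.1.1 x.1.2}) ?_ ?_ ?_ K
      fun _ => rfl⟩
  · intro K g hg R a ha haR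
    rw [show (fun i => g ⟨⟨_, a i⟩, ha i⟩) = fun i => f _ (a i) from funext fun i => hg _]
    exact hf R a haR
  · exact fun K L h g hg x => hg _
  · exact fun L K h _ g hg => ⟨fun x => f x.1.1 x.1.2, fun _ => rfl, funext fun x => (hg x).symm⟩

/-- With no types, a homomorphism to `botStr` exists iff the nullary relation is empty. A power of
`botStr` has a non-empty relation exactly when its exponent is empty. -/
theorem kappa_botStr_mapsTo_iff :
    (kappa k A botStr X).MapsTo botStr ↔ TestAccepts k A X := by
  constructor
  · rintro ⟨f, hf⟩ K hK
    by_contra hne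
    rw [Set.not_nonempty_iff_eq_empty] at hne
    exact hf () _ ⟨⟨K, hK⟩, fun i => i.elim0,
      fun j => (Set.eq_empty_iff_forall_notMem.1 hne j.1 j.2).elim, rfl⟩
  · refine fun h => ⟨fun t => Empty.elim t, ?_⟩
    rintro R a ⟨K, b, hb, -⟩
    obtain ⟨j, hj⟩ := h K.1 K.2
    exact hb ⟨j, hj⟩

theorem reducesByConsistency_botStr_iff {A' : Str.{u, v, w} P} :
    ReducesByConsistency k A A' botStr botStr ↔ HasWidth k A A' := by
  simp only [ReducesByConsistency, IsReduction, HasWidth, Solves, kappa_botStr_mapsTo_iff]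

end Consistency

/-! ### Datalog evaluation and consistent maps -/

namespace Program

variable {P : Signature.{u, v}} {φ : Program P}

theorem stage_mono (X : Str.{u, v, w} P) (Q : φ.I) : Monotone fun n => φ.stage X n Q :=
  monotone_nat_of_le_succ fun _ => Set.subset_union_left

theorem holds_expand_mono {X : Str.{u, v, w} P} {V : P.Ty → Type}
    {h : (t : P.Ty) → V t → X.dom t}
    {J J' : (Q : φ.I) → Set ((i : Fin (φ.arI Q).length) → X.dom ((φ.arI Q).get i))}
    (hJ : ∀ Q, J Q ⊆ J' Q) {a : Atom (P.extend φ.I φ.arI) V}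
    (ha : a.Holds (φ.expand X J) h) : a.Holds (φ.expand X J') h := by
  match a, ha with
  | .rel (.inl _) _, ha => exact ha
  | .rel (.inr Q) _, ha => exact hJ Q ha
  | .eq _ _ _, ha => exact ha

theorem exists_stage_of_holds_eval {X : Str.{u, v, w} P} {V : P.Ty → Type}
    {h : (t : P.Ty) → V t → X.dom t} {a : Atom (P.extend φ.I φ.arI) V}
    (ha : a.Holds (φ.eval X) h) : ∃ n, a.Holds (φ.expand X (φ.stage X n)) h := by
  match a, ha with
  | .rel (.inl _) _, ha => exact ⟨0, ha⟩
  | .rel (.inr _) _, ⟨n, hn⟩ => exact ⟨n, hn⟩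
  | .eq _ _ _, ha => exact ⟨0, ha⟩

/-- The fixed point of the evaluation is closed under the rules. -/
theorem mem_stage_of_body_holds {X : Str.{u, v, w} P} {r : Rule P φ.I φ.arI} (hr : r ∈ φ.rules)
    (h : (t : P.Ty) → Fin (r.nvar t) → X.dom t) (hb : ∀ a ∈ r.body, a.Holds (φ.eval X) h) :
    ∃ n, (fun i => h _ (r.headArgs i)) ∈ φ.stage X n r.head := by
  -- The body is finite and the stages increase, so all its atoms hold at one common stage.
  have key : ∀ l : List (Atom (P.extend φ.I φ.arI) fun t => Fin (r.nvar t)),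
      (∀ a ∈ l, a.Holds (φ.eval X) h) →
        ∃ n, ∀ a ∈ l, a.Holds (φ.expand X (φ.stage X n)) h := by
    intro l
    induction l with
    | nil => exact fun _ => ⟨0, by simp⟩
    | cons a l ih =>
      intro hl
      obtain ⟨n, hn⟩ := ih fun b hb => hl b (List.mem_cons_of_mem _ hb)
      obtain ⟨m, hm⟩ := exists_stage_of_holds_eval (φ := φ) (hl a List.mem_cons_self)
      refine ⟨max n m, fun b hb => ?_⟩
      rcases List.mem_cons.1 hb with rfl | hb
      · exact holds_expand_mono (fun Q => stage_mono X Q (le_max_right n m)) hm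
      · exact holds_expand_mono (fun Q => stage_mono X Q (le_max_left n m)) (hn b hb)
  obtain ⟨n, hn⟩ := key r.body hb
  exact ⟨n + 1, Or.inr ⟨r, hr, h, hn, rfl⟩⟩

/-- If `f` is a partial homomorphism on a small set in the output of the `k`-consistency algorithm,
then `f` preserves all facts derived by a Datalog program of width at most `k`. -/
theorem consistent_preserves_stage {k : ℕ} (hφ : φ.WidthAtMost k) {A X : Str.{u, v, w} P}
    (hA : A.IsFinite) (n : ℕ) (Q : φ.I)
    (y : (i : Fin (φ.arI Q).length) → X.dom ((φ.arI Q).get i)) (hy : y ∈ φ.stage X n Q)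
    (K : Finset X.Elem) (hyK : ∀ i, (⟨_, y i⟩ : X.Elem) ∈ K)
    (hK : ∀ x ∈ K, ∃ i, (⟨_, y i⟩ : X.Elem) = x)
    (f : PMap X A K) (hf : f ∈ consistent k A X K) :
    (fun i => f ⟨⟨_, y i⟩, hyK i⟩) ∈ φ.stage A n Q := by
  classical
  induction n generalizing Q K with
  | zero => exact hy.elim
  | succ n ih =>
    rcases hy with hy | ⟨r, hr, h, hb, hQ⟩
    · exact Or.inl (ih Q y hy K hyK hK f hf)
    right
    obtain ⟨rfl, hQ⟩ := Sigma.mk.inj hQ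
    obtain rfl := eq_of_heq hQ
    have hcard : ENat.card (Σ t, Fin (r.nvar t)) ≤ k := hφ r hr
    have : Finite (Σ t, Fin (r.nvar t)) :=
      ENat.card_lt_top.1 (hcard.trans_lt (ENat.natCast_lt_top k))
    have := Fintype.ofFinite (Σ t, Fin (r.nvar t))
    rw [ENat.card_eq_coe_fintype_card, Nat.cast_le] at hcard
    -- The elements touched by this instance of the rule. They include all of `K`, because `K`
    -- consists of entries of the head; this is why `hK` is assumed.
    let M : Finset X.Elem := Finset.univ.image fun x : Σ t, Fin (r.nvar t) => ⟨x.1, h x.1 x.2⟩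
    have hM : ∀ t i, (⟨t, h t i⟩ : X.Elem) ∈ M := fun t i =>
      Finset.mem_image.2 ⟨⟨t, i⟩, Finset.mem_univ _, rfl⟩
    have hKM : K ⊆ M := by
      intro x hx
      obtain ⟨i, rfl⟩ := hK x hx
      exact hM _ _
    obtain ⟨g, hg, rfl⟩ := exists_extension_mem_consistent hA hKM
      (Finset.card_image_le.trans hcard) hf
    refine ⟨r, hr, fun t i => g ⟨⟨t, h t i⟩, hM t i⟩, fun a ha => ?_, rfl⟩
    match a, hb a ha with
    | .rel (.inl R) z, hz => exact isPartialHom_of_mem_consistent hg R _ (fun i => hM _ (z i)) hz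
    | .rel (.inr Q') z, hz =>
      -- The induction hypothesis needs the exact set of entries of the atom, so `g` is restricted
      -- to it.
      have hsub : (Finset.univ.image fun i => (⟨_, h _ (z i)⟩ : X.Elem)) ⊆ M := by
        intro x hx
        obtain ⟨i, -, rfl⟩ := Finset.mem_image.1 hx
        exact hM _ _
      exact ih Q' (fun i => h _ (z i)) hz _
        (fun i => Finset.mem_image_of_mem _ (Finset.mem_univ i))
        (fun x hx => by
          obtain ⟨i, -, rfl⟩ := Finset.mem_image.1 hx
          exact ⟨i, rfl⟩) _ (restrict_mem_consistent hsub hg)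
    | .eq t i j, hz =>
      have hz : h t i = h t j := hz
      change g ⟨⟨t, h t i⟩, _⟩ = g ⟨⟨t, h t j⟩, _⟩
      have hg' : ∀ (x y : X.dom t) (hx : (⟨t, x⟩ : X.Elem) ∈ M) (hy : (⟨t, y⟩ : X.Elem) ∈ M),
          x = y → g ⟨⟨t, x⟩, hx⟩ = g ⟨⟨t, y⟩, hy⟩ := by
        rintro x _ _ _ rfl
        rfl
      exact hg' _ _ _ _ hz

/-- If the `k`-consistency test accepts `X`, then each Datalog sentence of width at most `k` that is
true in `X` is also true in `A`. -/
theorem IsTrue.of_testAccepts {k : ℕ} {A X : Str.{u, v, w} P} (hX : φ.IsTrue X)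
    (hs : φ.IsSentence) (hφ : φ.WidthAtMost k) (hA : A.IsFinite) (hacc : TestAccepts k A X) :
    φ.IsTrue A := by
  -- A nullary fact involves no elements, so a consistent map on the empty set suffices to transfer
  -- it.
  obtain ⟨f, hf⟩ := hacc ∅ (by simp)
  have hempty : IsEmpty (Fin ((P.extend φ.I φ.arI).ar φ.output).length) := by
    rw [show (P.extend φ.I φ.arI).ar φ.output = [] from hs]
    exact Fin.isEmpty
  unfold IsTrue at *
  generalize φ.output = o at *
  obtain ⟨y, hy⟩ := hX
  match o, hempty, y, hy with
  | .inl R, hempty, y, hy =>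
    exact ⟨_, isPartialHom_of_mem_consistent hf R y (fun i => hempty.elim i) hy⟩
  | .inr Q, hempty, y, ⟨n, hn⟩ =>
    exact ⟨_, n, consistent_preserves_stage hφ hA n Q y hn ∅ (fun i => hempty.elim i)
      (fun x hx => absurd hx (Finset.notMem_empty x)) f hf⟩

end Program

/-- If the test accepted a negative instance, the sentence would be true in `A`, which is a positive
instance by the identity. -/
theorem DatalogExpressible.hasWidth {P : Signature.{u, v}} {k : ℕ} {A A' : Str.{u, v, w} P}
    (hA : A.IsFinite) (h : DatalogExpressible k A A') : HasWidth k A A' := by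
  obtain ⟨φ, hs, hφ, hpos, hneg⟩ := h
  refine ⟨fun X _ hX => hX.testAccepts, fun X hX hXA hacc => ?_⟩
  exact hpos A hA ⟨fun _ a => a, fun _ _ ha => ha⟩
    ((not_not.1 (hneg X hX hXA)).of_testAccepts hs hφ hA hacc)

/-! ### Finiteness of the set of rules -/

theorem Atom.finite {S : Signature.{u, v}} (hS : S.IsFinite) {V : S.Ty → Type}
    (hV : ∀ t, Finite (V t)) : Finite (Atom S V) := by
  have := hS.1
  have := hS.2
  let F : ((Σ R : S.Sym, (i : Fin (S.ar R).length) → V ((S.ar R).get i)) ⊕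
      (Σ t : S.Ty, V t × V t)) → Atom S V :=
    Sum.elim (fun x => .rel x.1 x.2) fun x => .eq x.1 x.2.1 x.2.2
  refine Finite.of_surjective F ?_
  rintro (⟨R, x⟩ | ⟨t, x, y⟩)
  · exact ⟨.inl ⟨R, x⟩, rfl⟩
  · exact ⟨.inr ⟨t, x, y⟩, rfl⟩

theorem Signature.IsFinite.extend {S : Signature.{u, v}} (hS : S.IsFinite) {I : Type} [Finite I]
    (arI : I → List S.Ty) : (S.extend I arI).IsFinite := by
  have := hS.2
  exact ⟨hS.1, inferInstanceAs (Finite (S.Sym ⊕ I))⟩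

/-- There are finitely many rules with a bounded number of variables and without repetitions in the
body. -/
theorem Rule.finite_setOf_numVars_le {S : Signature.{u, v}} (hS : S.IsFinite) {I : Type}
    [Finite I] (arI : I → List S.Ty) (k : ℕ) :
    {r : Rule S I arI | r.numVars ≤ k ∧ r.body.Nodup}.Finite := by
  classical
  have := hS.1
  have hatom : ∀ nv : S.Ty → Fin (k + 1),
      Finite (Atom (S.extend I arI) fun t => Fin (nv t : ℕ)) :=
    fun nv => Atom.finite (hS.extend arI) fun t => inferInstanceAs (Finite (Fin (nv t : ℕ)))
  have hlist : ∀ nv : S.Ty → Fin (k + 1),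
      Finite {l : List (Atom (S.extend I arI) fun t => Fin (nv t : ℕ)) // l.Nodup} := by
    intro nv
    have := Fintype.ofFinite (Atom (S.extend I arI) fun t => Fin (nv t : ℕ))
    infer_instance
  -- The bound on all variables bounds the number of each type, and `Nodup` bounds the length of the
  -- body, so this code for rules ranges over a finite set.
  let Idx := Σ nv : S.Ty → Fin (k + 1), Σ Q : I,
    ((i : Fin (arI Q).length) → Fin (nv ((arI Q).get i) : ℕ)) ×
      {l : List (Atom (S.extend I arI) fun t => Fin (nv t : ℕ)) // l.Nodup}
  have : Finite Idx := inferInstance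
  let Occ (x : Idx) : Prop := ∀ z : (Σ t : S.Ty, Fin (x.1 t : ℕ)),
    (∃ i, (⟨(arI x.2.1).get i, x.2.2.1 i⟩ : Σ t : S.Ty, Fin (x.1 t : ℕ)) = z) ∨
      ∃ a ∈ x.2.2.2.1, Atom.Occurs (S := S.extend I arI) z a
  let F (x : {x : Idx // Occ x}) : Rule S I arI :=
    ⟨fun t => x.1.1 t, x.1.2.1, x.1.2.2.1, x.1.2.2.2.1, x.2⟩
  refine (Set.finite_range F).subset ?_
  rintro ⟨nvar, Q, z, body, occ⟩ ⟨hk, hb⟩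
  have hle : ∀ t, nvar t < k + 1 := by
    intro t
    have h : ENat.card (Fin (nvar t)) ≤ ENat.card (Σ t : S.Ty, Fin (nvar t)) :=
      ENat.card_le_card_of_injective (f := fun i => (⟨t, i⟩ : Σ t : S.Ty, Fin (nvar t)))
        fun i j hij => eq_of_heq (Sigma.mk.inj hij).2
    have h := h.trans hk
    rw [ENat.card_eq_coe_fintype_card, Fintype.card_fin, Nat.cast_le] at h
    exact Nat.lt_succ_of_le h
  exact ⟨⟨⟨fun t => ⟨nvar t, hle t⟩, Q, z, body, hb⟩, occ⟩, rfl⟩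

/-! ### The canonical Datalog program -/

/-- The extension of a structure by an interpretation of additional symbols. -/
def Str.extend {S : Signature.{u, v}} (A : Str.{u, v, w} S) {I : Type} {arI : I → List S.Ty}
    (val : (Q : I) → Set ((i : Fin (arI Q).length) → A.dom ((arI Q).get i))) :
    Str.{u, v, w} (S.extend I arI) where
  dom := A.dom
  rel
    | .inl R => A.rel R
    | .inr Q => val Q

/-- The rule `r` is valid in `A` when the additional symbols are interpreted by `val`. -/
def Rule.Valid {S : Signature.{u, v}} {I : Type} {arI : I → List S.Ty} (A : Str.{u, v, w} S)
    (val : (Q : I) → Set ((i : Fin (arI Q).length) → A.dom ((arI Q).get i)))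
    (r : Rule S I arI) : Prop :=
  ∀ g : (t : S.Ty) → Fin (r.nvar t) → A.dom t,
    (∀ a ∈ r.body, a.Holds (A.extend val) g) → (fun i => g _ (r.headArgs i)) ∈ val r.head

/-- The Datalog program that consists of all rules with at most `k` variables that are valid in
`A`. -/
def validProgram {P : Signature.{u, v}} (hP : P.IsFinite) (A : Str.{u, v, w} P) {I : Type}
    [hI : Finite I] {arI : I → List P.Ty}
    (val : (Q : I) → Set ((i : Fin (arI Q).length) → A.dom ((arI Q).get i))) (k : ℕ) (o : I) :
    Program P where
  I := I
  finite_I := hI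
  arI := arI
  rules := {r | (r.numVars ≤ k ∧ r.body.Nodup) ∧ r.Valid A val}
  finite_rules := (Rule.finite_setOf_numVars_le hP arI k).subset fun _ hr => hr.1
  output := .inr o

/-- The elements of a finite set in a structure can be listed as a tuple. -/
theorem exists_tuple_enumerating {T : Type*} {D : T → Type*} (l : List (Σ t, D t)) :
    ∃ (τ : List T) (y : (i : Fin τ.length) → D (τ.get i)), τ.length = l.length ∧
      ∀ x, x ∈ l ↔ ∃ i, (⟨τ.get i, y i⟩ : Σ t, D t) = x := by
  induction l with
  | nil => exact ⟨[], fun i => i.elim0, rfl, fun x => by simp⟩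
  | cons a l ih =>
    obtain ⟨τ, y, hlen, hy⟩ := ih
    let z : (i : Fin (τ.length + 1)) → D ((a.1 :: τ).get i) := Fin.cases a.2 y
    refine ⟨a.1 :: τ, z, by simp [hlen], fun x => ?_⟩
    rw [List.mem_cons, hy]
    refine Iff.trans ?_
      (Fin.exists_fin_succ (P := fun i => (⟨(a.1 :: τ).get i, z i⟩ : Σ t, D t) = x)).symm
    exact or_congr eq_comm Iff.rfl

namespace Program

variable {P : Signature.{u, v}} {hP : P.IsFinite} {A X : Str.{u, v, w} P} {I : Type} [Finite I]
  {arI : I → List P.Ty} {val : (Q : I) → Set ((i : Fin (arI Q).length) → A.dom ((arI Q).get i))}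
  {k : ℕ} {o : I}

/-- Homomorphisms to `A` preserve all derived facts. -/
theorem validProgram_stage_preserved (f : (t : P.Ty) → X.dom t → A.dom t)
    (hf : ∀ (R : P.Sym) (a : (i : Fin (P.ar R).length) → X.dom ((P.ar R).get i)),
      a ∈ X.rel R → (fun i => f _ (a i)) ∈ A.rel R) (n : ℕ) (Q : I)
    (y : (i : Fin (arI Q).length) → X.dom ((arI Q).get i))
    (hy : y ∈ (validProgram hP A val k o).stage X n Q) : (fun i => f _ (y i)) ∈ val Q := by
  induction n generalizing Q with
  | zero => exact hy.elim
  | succ n ih =>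
    rcases hy with hy | ⟨r, hr, h, hb, hQ⟩
    · exact ih Q y hy
    obtain ⟨rfl, hQ⟩ := Sigma.mk.inj hQ
    obtain rfl := eq_of_heq hQ
    refine hr.2 (fun t i => f t (h t i)) fun a ha => ?_
    match a, hb a ha with
    | .rel (.inl R) z, hz => exact hf R _ hz
    | .rel (.inr Q') z, hz => exact ih Q' _ hz
    | .eq t i j, hz => exact congrArg (f t) hz

/-- The maps that preserve the relations of `X` and all derived facts. -/
def preserving (hP : P.IsFinite) (A X : Str.{u, v, w} P)
    (val : (Q : I) → Set ((i : Fin (arI Q).length) → A.dom ((arI Q).get i)))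
    (k : ℕ) (o : I) (K : Finset X.Elem) : Set (PMap X A K) :=
  {f | f.IsPartialHom ∧ ∀ (n : ℕ) (Q : I) (y : (i : Fin (arI Q).length) → X.dom ((arI Q).get i))
    (hy : ∀ i, (⟨_, y i⟩ : X.Elem) ∈ K), y ∈ (validProgram hP A val k o).stage X n Q →
      (fun i => f ⟨⟨_, y i⟩, hy i⟩) ∈ val Q}

/-- A fact about a small set which is implied by the facts on that set is derived. -/
theorem exists_mem_stage_of_preserving (K : Finset X.Elem) (hK : K.card ≤ k) (Q : I)
    (y : (i : Fin (arI Q).length) → X.dom ((arI Q).get i))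
    (hy : ∀ i, (⟨_, y i⟩ : X.Elem) ∈ K)
    (himp : ∀ g ∈ preserving hP A X val k o K, (fun i => g ⟨⟨_, y i⟩, hy i⟩) ∈ val Q) :
    ∃ n, y ∈ (validProgram hP A val k o).stage X n Q := by
  classical
  have hfin : ∀ t, Finite {a : X.dom t // (⟨t, a⟩ : X.Elem) ∈ K} := fun t =>
    Finite.of_injective (β := K) (fun a => ⟨⟨t, a.1⟩, a.2⟩) fun a b hab =>
      Subtype.ext (sigma_mk_injective (Subtype.mk.inj hab))
  -- The rule to be applied has one variable for each element of `K`, and its body lists every atom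
  -- that holds on `K` in the fixed point.
  let nv : P.Ty → ℕ := fun t => Nat.card {a : X.dom t // (⟨t, a⟩ : X.Elem) ∈ K}
  let e : (t : P.Ty) → {a : X.dom t // (⟨t, a⟩ : X.Elem) ∈ K} ≃ Fin (nv t) :=
    fun t => Finite.equivFin _
  let h : (t : P.Ty) → Fin (nv t) → X.dom t := fun t i => ((e t).symm i).1
  have he : ∀ (t : P.Ty) (a : X.dom t) (ha : (⟨t, a⟩ : X.Elem) ∈ K), h t (e t ⟨a, ha⟩) = a := by
    intro t a ha
    simp [h]
  have : Finite (Atom (P.extend I arI) fun t => Fin (nv t)) :=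
    Atom.finite (hP.extend arI) fun t => inferInstanceAs (Finite (Fin (nv t)))
  let s : Set (Atom (P.extend I arI) fun t => Fin (nv t)) :=
    {a | a.Holds ((validProgram hP A val k o).eval X) h}
  have hs : s.Finite := s.toFinite
  let r : Rule P I arI :=
    { nvar := nv
      head := Q
      headArgs := fun i => e _ ⟨y i, hy i⟩
      body := hs.toFinset.toList
      -- The trivial equality `x = x` is among the true atoms, so every variable occurs.
      occurs := fun x => Or.inr ⟨.eq x.1 x.2 x.2,
        Finset.mem_toList.2 (hs.mem_toFinset.2 rfl), Or.inl rfl⟩ }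
  have hbody : ∀ a, a ∈ r.body ↔ a.Holds ((validProgram hP A val k o).eval X) h := fun a =>
    Finset.mem_toList.trans hs.mem_toFinset
  have hnum : r.numVars ≤ k := by
    have hinj : ENat.card (Σ t : P.Ty, Fin (nv t)) ≤ ENat.card K := by
      refine ENat.card_le_card_of_injective
        (f := fun x => ⟨⟨x.1, h x.1 x.2⟩, ((e x.1).symm x.2).2⟩) ?_
      rintro ⟨t, i⟩ ⟨t', j⟩ hij
      obtain ⟨rfl, hij⟩ := Sigma.mk.inj (Subtype.mk.inj hij)
      exact congrArg (Sigma.mk t) ((e t).symm.injective (Subtype.ext (eq_of_heq hij)))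
    rw [ENat.card_eq_coe_fintype_card (α := K), Fintype.card_coe] at hinj
    exact hinj.trans (Nat.cast_le.2 hK)
  have hvalid : r.Valid A val := by
    intro g hg
    -- An assignment in `A` satisfying the body is the same thing as a map on `K` that preserves all
    -- input and derived facts there.
    refine himp (fun x => g x.1.1 (e x.1.1 ⟨x.1.2, x.2⟩)) ⟨?_, ?_⟩
    · intro R a ha haR
      refine hg (.rel (.inl R) fun i => e _ ⟨a i, ha i⟩) ((hbody _).2 ?_)
      change (fun i => h _ (e _ ⟨a i, ha i⟩)) ∈ X.rel R
      simpa only [he] using haR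
    · intro n Q' z hz hzn
      refine hg (.rel (.inr Q') fun i => e _ ⟨z i, hz i⟩) ((hbody _).2 ?_)
      change (fun i => h _ (e _ ⟨z i, hz i⟩)) ∈
        {z | ∃ n, z ∈ (validProgram hP A val k o).stage X n Q'}
      simp only [he]
      exact ⟨n, hzn⟩
  obtain ⟨n, hn⟩ := mem_stage_of_body_holds (φ := validProgram hP A val k o) (r := r)
    ⟨⟨hnum, Finset.nodup_toList _⟩, hvalid⟩ h fun a ha => (hbody a).1 ha
  have hhead : (fun i => h _ (r.headArgs i)) = y := funext fun i => he _ _ _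
  exact ⟨n, Set.mem_of_eq_of_mem hhead.symm hn⟩

theorem restrict_mem_preserving {K L : Finset X.Elem} (h : L ⊆ K) {f : PMap X A K}
    (hf : f ∈ preserving hP A X val k o K) : f.restrict h ∈ preserving hP A X val k o L :=
  ⟨fun R a ha haR => hf.1 R a (fun i => h (ha i)) haR,
    fun n Q y hy hyn => hf.2 n Q y (fun i => h (hy i)) hyn⟩

/-- If every relation on `A` of arity at most `k` is named by an additional symbol, then the maps
preserving all derived facts have the extension property. -/
theorem exists_extension_mem_preserving
    (hval : ∀ p : Σ τ : List P.Ty, Set ((i : Fin τ.length) → A.dom (τ.get i)),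
      p.1.length ≤ k → ∃ Q, ⟨arI Q, val Q⟩ = p)
    {L K : Finset X.Elem} (h : L ⊆ K) (hK : K.card ≤ k) {f : PMap X A L}
    (hf : f ∈ preserving hP A X val k o L) :
    ∃ g ∈ preserving hP A X val k o K, g.restrict h = f := by
  obtain ⟨τ, y, hlen, hy⟩ := exists_tuple_enumerating L.toList
  simp only [Finset.mem_toList] at hy
  have hyL : ∀ i, (⟨τ.get i, y i⟩ : X.Elem) ∈ L := fun i => (hy _).2 ⟨i, rfl⟩
  rw [Finset.length_toList] at hlen
  -- Stated for pairs of an arity and a relation, so that the pair can be replaced by a named symbol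
  -- without transport along an equality of arities.
  have key : ∀ p : Σ τ : List P.Ty, Set ((i : Fin τ.length) → A.dom (τ.get i)),
      p.1.length ≤ k → ∀ (y : (i : Fin p.1.length) → X.dom (p.1.get i))
        (hyL : ∀ i, (⟨p.1.get i, y i⟩ : X.Elem) ∈ L),
        (∀ g ∈ preserving hP A X val k o K, (fun i => g ⟨⟨_, y i⟩, h (hyL i)⟩) ∈ p.2) →
        (fun i => f ⟨⟨_, y i⟩, hyL i⟩) ∈ p.2 := by
    intro p hp
    obtain ⟨Q, rfl⟩ := hval p hp
    intro y hyL himp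
    obtain ⟨n, hn⟩ := exists_mem_stage_of_preserving K hK Q y (fun i => h (hyL i)) himp
    exact hf.2 n Q y hyL hn
  -- The relation consists of the traces on `L` of all preserving maps on `K`. Its symbol is derived
  -- at `y`, so `f` must itself be such a trace.
  obtain ⟨g, hg, hgf⟩ := key ⟨τ, {z | ∃ g ∈ preserving hP A X val k o K,
      (fun i => g ⟨⟨_, y i⟩, h (hyL i)⟩) = z}⟩
    (hlen.le.trans ((Finset.card_le_card h).trans hK)) y hyL fun g hg => ⟨g, hg, rfl⟩
  refine ⟨g, hg, funext fun x => ?_⟩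
  obtain ⟨x, hx⟩ := x
  obtain ⟨i, rfl⟩ := (hy x).1 hx
  exact congrFun hgf i

/-- If the output symbol names the empty nullary relation and the output is not derived, then the
`k`-consistency test accepts. -/
theorem testAccepts_of_not_isTrue_validProgram
    (hval : ∀ p : Σ τ : List P.Ty, Set ((i : Fin τ.length) → A.dom (τ.get i)),
      p.1.length ≤ k → ∃ Q, ⟨arI Q, val Q⟩ = p)
    (ho : arI o = []) (hX : ¬ (validProgram hP A val k o).IsTrue X) : TestAccepts k A X := by
  intro K hK
  have hempty : IsEmpty (Fin (arI o).length) := by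
    rw [ho]
    exact Fin.isEmpty
  have hne : (preserving hP A X val k o K).Nonempty := by
    by_contra hne
    rw [Set.not_nonempty_iff_eq_empty] at hne
    -- With no preserving map on `K`, every fact about `K` is implied vacuously, including the
    -- output.
    exact hX ⟨_, exists_mem_stage_of_preserving (hP := hP) (val := val) (o := o) K hK o
      (fun i => hempty.elim i) (fun i => hempty.elim i)
      fun g hg => (Set.eq_empty_iff_forall_notMem.1 hne g hg).elim⟩
  exact hne.mono (subset_consistent (preserving hP A X val k o) (fun _ _ hf => hf.1)
    (fun _ _ h _ hf => restrict_mem_preserving h hf)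
    (fun _ _ h hK _ hf => exists_extension_mem_preserving hval h hK hf) K)

end Program

/-- The canonical program works: a homomorphism to `A` would carry a derived output into the empty
relation, and an instance without derived output is accepted by the test, hence not negative. -/
theorem HasWidth.datalogExpressible {P : Signature.{u, v}} (hP : P.IsFinite) {k : ℕ}
    {A A' : Str.{u, v, w} P} (hA : A.IsFinite) (h : HasWidth k A A') :
    DatalogExpressible k A A' := by
  have := hP.1
  have : ∀ t, Finite (A.dom t) := hA
  have : Finite {τ : List P.Ty // τ.length ≤ k} := (List.finite_length_le P.Ty k).to_subtype
  -- The symbols of a program live in `Type`, so the finitely many relations on `A` of arity at most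
  -- `k` are numbered by `Fin n`.
  obtain ⟨n, ⟨e⟩⟩ := Finite.exists_equiv_fin (Σ τ : {τ : List P.Ty // τ.length ≤ k},
    Set ((i : Fin τ.1.length) → A.dom (τ.1.get i)))
  let arI : Fin n → List P.Ty := fun Q => (e.symm Q).1.1
  let val : (Q : Fin n) → Set ((i : Fin (arI Q).length) → A.dom ((arI Q).get i)) :=
    fun Q => (e.symm Q).2
  have hval : ∀ p : Σ τ : List P.Ty, Set ((i : Fin τ.length) → A.dom (τ.get i)),
      p.1.length ≤ k → ∃ Q, ⟨arI Q, val Q⟩ = p := by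
    rintro ⟨τ, S⟩ hτ
    obtain ⟨Q, hQ⟩ := e.symm.surjective ⟨⟨τ, hτ⟩, S⟩
    exact ⟨Q, congrArg (fun p : (Σ τ : {τ : List P.Ty // τ.length ≤ k},
      Set ((i : Fin τ.1.length) → A.dom (τ.1.get i))) =>
        (⟨p.1.1, p.2⟩ : Σ τ : List P.Ty, Set ((i : Fin τ.length) → A.dom (τ.get i)))) hQ⟩
  obtain ⟨o, ho⟩ := hval ⟨[], ∅⟩ (Nat.zero_le k)
  have harI : arI o = [] := congrArg Sigma.fst ho
  have hemp : val o = ∅ := by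
    have : ∀ p : Σ τ : List P.Ty, Set ((i : Fin τ.length) → A.dom (τ.get i)),
        p = ⟨[], ∅⟩ → p.2 = ∅ := by
      rintro _ rfl
      rfl
    exact this _ ho
  refine ⟨validProgram hP A val k o, harI, fun r hr => hr.1.1, ?_, ?_⟩
  · rintro X - ⟨f, hf⟩ ⟨y, m, hy⟩
    have := Program.validProgram_stage_preserved (hP := hP) (val := val) (k := k) (o := o)
      f hf m o y hy
    rw [hemp] at this
    exact this
  · intro X hX hXA hφ
    exact h.2 X hX hXA (Program.testAccepts_of_not_isTrue_validProgram hval harI hφ)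

end PCSP

/-- A promise CSP (with finite signature and template `(A, A')`, `A` finite, `A` mapping to `A'`)
has width `k`, i.e. is solved by the `k`-consistency test, if and only if it reduces to the trivial
CSP by the `k`-consistency reduction; and this is also equivalent to expressibility by a Datalog
sentence of width at most `k`. -/
theorem theorem4p1 {P : PCSP.Signature} (hP : P.IsFinite) (A A' : PCSP.Str P)
    (hA : A.IsFinite) (hAA' : A.MapsTo A') (k : ℕ) (hk : 1 ≤ k) :
    (PCSP.HasWidth k A A' ↔ PCSP.ReducesByConsistency k A A' PCSP.botStr PCSP.botStr) ∧
    (PCSP.HasWidth k A A' ↔ PCSP.DatalogExpressible k A A') := by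
  exact ⟨PCSP.reducesByConsistency_botStr_iff.symm,
    fun h => h.datalogExpressible hP hA, fun h => h.hasWidth hA⟩
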